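/- Let $G$ be a finite simple connected graph that contains no induced subgraph isomorphic to any of the following: the path $P_7$ on seven vertices, the cycle $C_7$ on seven vertices, the cycle $C_4$ on four vertices, or the diamond (the complete graph $K_4$ minus one edge). Then at least one of the following holds: 1. $G$ is isomorphic to the Petersen graph; 2. $G$ has a clique-cutset, that is, a set $K$ of pairwise adjacent vertices such that $G \setminus K$ has more connected components than $G$; 3. $G$ has a vertex of degree at most $\omega(G)$, where $\omega(G)$ denotes the maximum size of a clique in $G$. -/

import Mathlib

namespace SimpleGraph

/-- `G` is `H`-free: no induced subgraph of `G` is isomorphic to `H`. -/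
def IndFree {W V : Type*} (H : SimpleGraph W) (G : SimpleGraph V) : Prop :=
  ¬ H.IsIndContained G

/-- The diamond: the complete graph on four vertices minus one edge. -/
def diamondGraph : SimpleGraph (Fin 4) :=
  (⊤ : SimpleGraph (Fin 4)).deleteEdges {s(0, 1)}

/-- The Petersen graph: an outer 5-cycle on `0, …, 4`, five spokes `i — i + 5`, and an inner
pentagram on `5, …, 9`. -/
def petersenGraph : SimpleGraph (Fin 10) :=
  fromEdgeSet
    {s(0, 1), s(1, 2), s(2, 3), s(3, 4), s(4, 0),
     s(0, 5), s(1, 6), s(2, 7), s(3, 8), s(4, 9),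
     s(5, 7), s(7, 9), s(9, 6), s(6, 8), s(8, 5)}

/-- A clique `K` of `G` is a clique-cutset if deleting the vertices of `K` from `G` leaves a graph
with more connected components than `G` has. -/
def IsCliqueCutset {V : Type*} (G : SimpleGraph V) (K : Set V) : Prop :=
  G.IsClique K ∧
    Nat.card G.ConnectedComponent < Nat.card (G.induce Kᶜ).ConnectedComponent

end SimpleGraph

/-! Suppose every degree exceeds ω; it is shown that `G` is the Petersen graph. Excluding `C₄` and
the diamond means that distinct nonadjacent vertices have at most one common neighbour
(`eq_of_common_neighbors`). Hence the ends of an edge `vu` and their common neighbours form a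
clique, and since `deg v > ω`, `v` has two further neighbours not adjacent to `u`
(`exists_two_neighbors_not_adj`). This drives a finite search over induced subgraphs. Where at most
one such neighbour of `v` is present, another lies outside; it is added with every neighbourhood
compatible with the common-neighbour condition, and branches with an induced `P₇` or `C₇` are cut.
From an edge, all surviving branches contain a Petersen graph (`search_edge`). From a Petersen graph
with an attached vertex, none survives (`search_petersen_extension`), so by connectedness the
Petersen graph is all of `G`. Tests that cut branches need only be sound: missing a path merely
enlarges the search. -/

/-! A graph on `0, …, n - 1` is encoded by its list of neighbourhoods, each of them a bit mask.
All functions below are evaluated by the kernel, so they use `Nat.rec` and the binary natural number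
operations directly, and `force` normalises intermediate results. -/

namespace InducedSearch

/-- `force n k` is `k n`, evaluated by the kernel with `n` reduced to a literal. -/
def force {α : Type} (n : ℕ) (k : ℕ → α) : α :=
  Nat.casesOn n (k 0) fun m => k (Nat.succ m)

/-- `forceList l k` is `k l`, evaluated by the kernel with the entries of `l` reduced to literals. -/
def forceList : List ℕ → (List ℕ → Bool) → Bool
  | [], k => k []
  | n :: l, k => force n fun n => forceList l fun l' => k (n :: l')

/-- The `i`-th entry of a list, or `0`. -/
def row (R : List ℕ) (i : ℕ) : ℕ :=
  List.rec (fun _ => 0) (fun r _ ih i => Nat.casesOn i r ih) R i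

/-- The `i`-th binary digit of `x`. -/
def bit (x i : ℕ) : Bool := Nat.beq (Nat.land (Nat.shiftRight x i) 1) 1

/-- At most one binary digit of `x` is `1`. -/
def atMostOne (x : ℕ) : Bool := Nat.beq x 0 || Nat.beq x (Nat.pow 2 x.log2)

/-- The difference of two bit masks. -/
def diff (x y : ℕ) : ℕ := Nat.xor x (Nat.land x y)

/-- Some element of the mask `c` satisfies `p`; at most `k` elements are tried. -/
def anyBit (p : ℕ → Bool) (k c : ℕ) : Bool :=
  Nat.rec (fun _ => false)
    (fun _ ih c => bif Nat.beq c 0 then false else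
      force c.log2 fun i => p i || force (Nat.xor c (Nat.pow 2 i)) ih) k c

/-- An induced path with `k + 1` edges starts at `x` and avoids `F` after `x`, and avoids `N`
strictly between its ends; `n` bounds the number of vertices. -/
def longPath (R : List ℕ) (n N k : ℕ) : ℕ → ℕ → Bool :=
  Nat.rec (fun x F => !Nat.beq (diff (row R x) F) 0)
    (fun _ ih x F => force (Nat.lor F (row R x)) fun F' =>
      anyBit (fun y => ih y F') n (diff (row R x) (Nat.lor F N))) k

/-- There is an induced path on seven vertices starting at `w`, or an induced cycle on seven
vertices through `w`. -/
def hasPath (R : List ℕ) (w : ℕ) : Bool :=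
  force (row R w) fun N => force (Nat.pow 2 w) fun F =>
    anyBit (fun y => longPath R w N 4 y F) w N

/-- A vertex with earlier neighbours `S` may also be adjacent to `i`. -/
def compatible (R : List ℕ) (i S : ℕ) : Bool :=
  force (row R i) fun N => !anyBit (fun b => force (Nat.land N (row R b)) fun C =>
    !(bif bit N b then Nat.beq (Nat.lor S (Nat.mod C (Nat.pow 2 i))) S else Nat.beq C 0)) i S

/-- `p` holds for all masks that extend `S` on `i, …, i + k - 1`, contain `v`, avoid `u`, and can be
the neighbourhood of a new vertex. -/
def allMasks (R : List ℕ) (v u : ℕ) (p : ℕ → Bool) (k : ℕ) : ℕ → ℕ → Bool :=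
  Nat.rec (fun _ S => p S) (fun _ ih i S => force (row R i) fun N =>
    ((bit v i || !atMostOne (Nat.land S N)) || ih (Nat.succ i) S) &&
    ((bit u i || !compatible R i S) || force (Nat.lor S (Nat.pow 2 i)) (ih (Nat.succ i)))) k

/-- Auxiliary to `addVertex`: the rows of `R` have numbers `i, i + 1, …`. -/
def addRows (n S : ℕ) : ℕ → List ℕ → List ℕ
  | _, [] => [S]
  | i, r :: R => (bif bit S i then Nat.lor r (Nat.pow 2 n) else r) :: addRows n S (i + 1) R

/-- Add a new last vertex with neighbourhood `S`. -/
def addVertex (R : List ℕ) (S : ℕ) : List ℕ := addRows R.length S 0 R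

/-- `u` is adjacent to `v`, and at most one other neighbour of `v` is not adjacent to `u`. -/
def deficient (R : List ℕ) (v u : ℕ) : Bool :=
  bit (row R v) u && atMostOne (diff (row R v) (Nat.lor (row R u) (Nat.pow 2 u)))

/-- All pairs of vertices, those with a late first entry first. -/
def pairs (R : List ℕ) : List (ℕ × ℕ) :=
  (List.range R.length).reverse.flatMap fun v => (List.range R.length).map fun u => (v, u)

/-- The list `l` of vertices of `R` can be prolonged by `k` entries to an induced copy of `Q`. -/
def embeds (R Q : List ℕ) : ℕ → List ℕ → Bool
  | 0, _ => true
  | k + 1, l => (List.range R.length).any fun y => force y fun y =>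
      ((List.range l.length).all fun j => bit (row R y) (row l j) == bit (row Q l.length) j) &&
        embeds R Q k (l ++ [y])

/-- The neighbourhoods in the Petersen graph. -/
def petersenRows : List ℕ := [50, 69, 138, 276, 521, 385, 770, 548, 104, 208]

/-- Keep adding neighbours to deficient vertices, in all possible ways, until no vertex is deficient.
The resulting graphs satisfy `leaf`. -/
def search (leaf : List ℕ → Bool) : ℕ → List ℕ → Bool
  | 0, _ => false
  | k + 1, R => match (pairs R).find? fun p => deficient R p.1 p.2 with
    | some (v, u) => force (2 ^ v) fun v => force (2 ^ u) fun u => force R.length fun n =>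
        allMasks R v u (fun S =>
          forceList (addVertex R S) fun R' => hasPath R' n || search leaf k R') n 0 0
    | none => leaf R

/-- The search from a single edge only ends in graphs that contain a Petersen graph. -/
theorem search_edge : search (fun R => embeds R petersenRows 10 []) 12 [2, 1] = true := by
  decide +kernel

/-- The search from a Petersen graph with a further vertex attached to it never ends. -/
theorem search_petersen_extension : allMasks petersenRows 0 0 (fun S => Nat.beq S 0 ||
    forceList (addVertex petersenRows S) fun R' => hasPath R' 10 ||
      search (fun _ => false) 3 R') 10 0 0 = true := by
  decide +kernel

/-! ### Semantics of the bit mask operations -/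

theorem force_eq {α : Type} (n : ℕ) (k : ℕ → α) : force n k = k n := by cases n <;> rfl

theorem forceList_eq (l : List ℕ) (k : List ℕ → Bool) : forceList l k = k l := by
  induction l generalizing k with
  | nil => rfl
  | cons n l ih => simp only [forceList, force_eq, ih]

theorem row_eq (R : List ℕ) (i : ℕ) : row R i = R.getD i 0 := by
  induction R generalizing i with
  | nil => simp [row]
  | cons r R ih =>
    cases i with
    | zero => rfl
    | succ i => exact (ih i).trans (List.getD_cons_succ ..).symm

theorem bit_eq (x i : ℕ) : bit x i = x.testBit i := by
  change Nat.beq ((x >>> i) &&& 1) 1 = _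
  rw [Nat.testBit, Nat.and_comm, Nat.one_and_eq_mod_two]
  rcases Nat.mod_two_eq_zero_or_one (x >>> i) with h | h <;> rw [h] <;> rfl

theorem bit_lor (x y i : ℕ) : bit (Nat.lor x y) i = (bit x i || bit y i) := by
  simp only [bit_eq]; exact Nat.testBit_or x y i

theorem bit_land (x y i : ℕ) : bit (Nat.land x y) i = (bit x i && bit y i) := by
  simp only [bit_eq]; exact Nat.testBit_and x y i

theorem bit_xor (x y i : ℕ) : bit (Nat.xor x y) i = (bit x i ^^ bit y i) := by
  simp only [bit_eq]; exact Nat.testBit_xor x y i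

theorem bit_diff (x y i : ℕ) : bit (diff x y) i = (bit x i && !bit y i) := by
  rw [diff, bit_xor, bit_land]; cases bit x i <;> cases bit y i <;> rfl

theorem bit_pow (n i : ℕ) : bit (Nat.pow 2 n) i = decide (n = i) := by
  rw [bit_eq]; exact Nat.testBit_two_pow

theorem bit_mod (x n i : ℕ) : bit (Nat.mod x (Nat.pow 2 n)) i = (decide (i < n) && bit x i) := by
  simp only [bit_eq]; exact Nat.testBit_mod_two_pow x n i

theorem bit_zero (i : ℕ) : bit 0 i = false := by rw [bit_eq]; exact Nat.zero_testBit i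

theorem lt_length_of_bit {R : List ℕ} {i j : ℕ} (hij : bit (row R i) j = true) :
    i < R.length := by
  by_contra hi
  rw [row_eq, List.getD_eq_default _ _ (not_lt.1 hi), bit_zero] at hij
  cases hij

theorem bit_ext {x y : ℕ} (h : ∀ i, bit x i = true ↔ bit y i = true) : x = y := by
  refine Nat.eq_of_testBit_eq fun i => ?_
  rw [← bit_eq, ← bit_eq, Bool.eq_iff_iff]
  exact h i

theorem bit_log2 {x : ℕ} (h : x ≠ 0) : bit x x.log2 = true := by
  rw [bit_eq]; exact Nat.testBit_log2 h

theorem exists_bit {x : ℕ} (h : x ≠ 0) : ∃ i, bit x i = true := ⟨_, bit_log2 h⟩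

theorem exists_mask (P : ℕ → Prop) (n : ℕ) : ∃ S, ∀ j, bit S j = true ↔ j < n ∧ P j := by
  induction n with
  | zero => exact ⟨0, by simp [bit_zero]⟩
  | succ n ih =>
    obtain ⟨S, hS⟩ := ih
    by_cases h : P n
    · refine ⟨Nat.lor S (Nat.pow 2 n), fun j => ?_⟩
      rw [bit_lor, bit_pow, Bool.or_eq_true, hS, decide_eq_true_eq]
      grind
    · exact ⟨S, fun j => by rw [hS]; grind⟩

theorem atMostOne_iff {x : ℕ} :
    atMostOne x = true ↔ ∀ b c, bit x b = true → bit x c = true → b = c := by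
  rw [atMostOne, Bool.or_eq_true, Nat.beq_eq, Nat.beq_eq]
  constructor
  · rintro (h | h) b c hb hc
    · simp [h, bit_zero] at hb
    · rw [h, bit_pow, decide_eq_true_eq] at hb hc
      exact hb.symm.trans hc
  · intro h
    refine or_iff_not_imp_left.2 fun h0 => bit_ext fun i => ?_
    rw [bit_pow, decide_eq_true_eq]
    exact ⟨fun hi => h _ _ (bit_log2 h0) hi, fun hi => hi ▸ bit_log2 h0⟩

/-! ### Soundness of the tests used by the search -/

theorem exists_of_anyBit {p : ℕ → Bool} {k c : ℕ} (h : anyBit p k c = true) :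
    ∃ i, bit c i = true ∧ p i = true := by
  induction k generalizing c with
  | zero => cases h
  | succ k ih =>
    change (bif Nat.beq c 0 then false else force c.log2 fun i =>
      p i || force (Nat.xor c (Nat.pow 2 i)) (anyBit p k)) = true at h
    by_cases h0 : c = 0
    · simp [h0] at h
    · rw [Bool.eq_false_iff.2 (mt Nat.eq_of_beq_eq_true h0), cond_false, force_eq, force_eq,
        Bool.or_eq_true] at h
      obtain h | h := h
      · exact ⟨_, bit_log2 h0, h⟩
      · obtain ⟨i, hi, hp⟩ := ih h
        refine ⟨i, ?_, hp⟩
        rw [bit_xor, bit_pow] at hi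
        by_cases e : c.log2 = i
        · exact e ▸ bit_log2 h0
        · simpa [e] using hi

/-- The vertices `x :: l` form an induced path in `R`. -/
def IsInducedPath (R : List ℕ) : ℕ → List ℕ → Prop
  | _, [] => True
  | x, y :: l => bit (row R x) y = true ∧ (∀ z ∈ l, bit (row R x) z = false) ∧ IsInducedPath R y l

/-- `F` collects the neighbours of the path vertices already left, so avoiding it rules out chords.
`N` is not avoided by the last entry, which may close a cycle. -/
theorem exists_of_longPath {R : List ℕ} {n N k x F : ℕ} (h : longPath R n N k x F = true) :
    ∃ l : List ℕ, l.length = k + 1 ∧ IsInducedPath R x l ∧ (∀ z ∈ l, bit F z = false) ∧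
      ∀ z ∈ l.dropLast, bit N z = false := by
  induction k generalizing x F with
  | zero =>
    change (!Nat.beq (diff (row R x) F) 0) = true at h
    obtain ⟨y, hy⟩ := exists_bit (x := diff (row R x) F) (by rintro e; simp [e] at h)
    rw [bit_diff] at hy
    exact ⟨[y], by simpa [IsInducedPath] using hy⟩
  | succ k ih =>
    change (force (Nat.lor F (row R x)) fun F' =>
      anyBit (fun y => longPath R n N k y F') n (diff (row R x) (Nat.lor F N))) = true at h
    rw [force_eq] at h
    obtain ⟨y, hy, h⟩ := exists_of_anyBit h
    obtain ⟨l, hl, hp, hF, hN⟩ := ih h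
    simp only [bit_lor, Bool.or_eq_false_iff] at hF
    simp only [bit_diff, bit_lor, Bool.and_eq_true, Bool.not_eq_true', Bool.or_eq_false_iff] at hy
    refine ⟨y :: l, by simp [hl], ⟨hy.1, fun z hz => (hF z hz).2, hp⟩, ?_, ?_⟩
    · simpa [hy.2.1] using fun z hz => (hF z hz).1
    · rw [List.dropLast_cons_of_ne_nil (by rintro rfl; simp at hl)]
      simpa [hy.2.2] using hN

theorem exists_of_hasPath {R : List ℕ} {w : ℕ} (h : hasPath R w = true) :
    ∃ a b c d e f, IsInducedPath R a [b, c, d, e, f] ∧ bit (row R w) a = true ∧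
      ∀ z ∈ [b, c, d, e], bit (row R w) z = false := by
  rw [hasPath, force_eq, force_eq] at h
  obtain ⟨a, ha, h⟩ := exists_of_anyBit h
  obtain ⟨l, hl, hp, -, hN⟩ := exists_of_longPath h
  match l, hl with
  | [b, c, d, e, f], _ => exact ⟨a, b, c, d, e, f, hp, ha, hN⟩

theorem addRows_length (n S i : ℕ) (R : List ℕ) : (addRows n S i R).length = R.length + 1 := by
  induction R generalizing i with
  | nil => rfl
  | cons r R ih => simp [addRows, ih]

theorem addVertex_length (R : List ℕ) (S : ℕ) : (addVertex R S).length = R.length + 1 :=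
  addRows_length ..

theorem row_addRows (n S i : ℕ) (R : List ℕ) (j : ℕ) : row (addRows n S i R) j =
    if j < R.length then bif bit S (i + j) then Nat.lor (row R j) (Nat.pow 2 n) else row R j
    else if j = R.length then S else 0 := by
  induction R generalizing i j with
  | nil => cases j <;> simp [addRows, row]
  | cons r R ih =>
    cases j with
    | zero => simp [addRows, row]
    | succ j =>
      change row (addRows n S (i + 1) R) j = _
      rw [ih, show i + 1 + j = i + (j + 1) by omega]
      simp [row]

theorem row_addVertex_of_lt {R : List ℕ} {S j : ℕ} (h : j < R.length) : row (addVertex R S) j =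
    bif bit S j then Nat.lor (row R j) (Nat.pow 2 R.length) else row R j := by
  rw [addVertex, row_addRows, if_pos h, Nat.zero_add]

theorem row_addVertex_length (R : List ℕ) (S : ℕ) : row (addVertex R S) R.length = S := by
  rw [addVertex, row_addRows, if_neg (lt_irrefl _), if_pos rfl]

/-- If `T` is a possible neighbourhood of a new vertex, then `allMasks` examines it. -/
theorem of_allMasks {R : List ℕ} {v u : ℕ} {p : ℕ → Bool} {n T : ℕ}
    (h : allMasks R v u p n 0 0 = true) (hn : ∀ i, bit T i = true → i < n)
    (hv : ∀ i, bit v i = true → bit T i = true) (hu : ∀ i, bit u i = true → bit T i = false)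
    (h₁ : ∀ i < n, bit T i = false → ∀ b c, bit T b = true → bit T c = true →
      bit (row R i) b = true → bit (row R i) c = true → b = c)
    (h₂ : ∀ i b, i ≠ b → bit T i = true → bit T b = true → ∀ c, bit (row R i) c = true →
      bit (row R b) c = true → bit (row R i) b = true ∧ bit T c = true) : p T = true := by
  -- Follow the branch on which `S` is the part of `T` below `i`; the conditions on `T` show that it
  -- is never pruned.
  suffices H : ∀ k i S, i + k = n → (∀ j, bit S j = true ↔ j < i ∧ bit T j = true) →
      allMasks R v u p k i S = true → p T = true from
    H n 0 0 (Nat.zero_add n) (by simp [bit_zero]) h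
  intro k
  induction k with
  | zero =>
    intro i S hi hS h
    have : S = T := bit_ext fun j => by
      rw [hS]
      exact ⟨And.right, fun hj => ⟨by have := hn j hj; omega, hj⟩⟩
    exact this ▸ h
  | succ k ih =>
    intro i S hi hS h
    change (force (row R i) fun N =>
      ((bit v i || !atMostOne (Nat.land S N)) || allMasks R v u p k (Nat.succ i) S) &&
      ((bit u i || !compatible R i S) || force (Nat.lor S (Nat.pow 2 i))
        (allMasks R v u p k (Nat.succ i)))) = true at h
    rw [force_eq, force_eq, Bool.and_eq_true] at h
    cases hT : bit T i with
    | false =>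
      have h' := h.1
      have hvi : bit v i = false := by
        by_contra hc
        rw [Bool.not_eq_false] at hc
        simp [hv i hc] at hT
      have hone : atMostOne (Nat.land S (row R i)) = true := by
        rw [atMostOne_iff]
        intro b c hb hc
        simp only [bit_land, Bool.and_eq_true, hS] at hb hc
        exact h₁ i (by omega) hT b c hb.1.2 hc.1.2 hb.2 hc.2
      rw [hvi, hone] at h'
      refine ih (i + 1) S (by omega) (fun j => ?_) h'
      rw [hS]
      grind
    | true =>
      have h' := h.2
      have hui : bit u i = false := by
        by_contra hc
        rw [Bool.not_eq_false] at hc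
        simp [hu i hc] at hT
      have hcomp : compatible R i S = true := by
        rw [compatible, force_eq, Bool.not_eq_true']
        by_contra hc
        rw [Bool.not_eq_false] at hc
        obtain ⟨b, hb, hc⟩ := exists_of_anyBit hc
        rw [hS] at hb
        have key := h₂ i b (by omega) hT hb.2
        rw [force_eq, Bool.not_eq_true'] at hc
        cases hib : bit (row R i) b with
        | true =>
          rw [hib, cond_true, ← Bool.not_eq_true, Nat.beq_eq] at hc
          refine hc (bit_ext fun j => ?_)
          rw [bit_lor, bit_mod, bit_land, hS]
          simp only [Bool.or_eq_true, Bool.and_eq_true, decide_eq_true_eq, hS]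
          exact ⟨fun hj => hj.elim id fun hj => ⟨hj.1, (key j hj.2.1 hj.2.2).2⟩, Or.inl⟩
        | false =>
          rw [hib, cond_false, ← Bool.not_eq_true, Nat.beq_eq] at hc
          obtain ⟨j, hj⟩ := exists_bit hc
          rw [bit_land, Bool.and_eq_true] at hj
          have := (key j hj.1 hj.2).1
          simp [hib] at this
      rw [hui, hcomp] at h'
      refine ih (i + 1) _ (by omega) (fun j => ?_) h'
      rw [bit_lor, bit_pow, Bool.or_eq_true, hS, decide_eq_true_eq]
      grind

/-- Distinctness of the new entries is not recorded; for the Petersen graph it follows from the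
adjacencies. -/
theorem exists_of_embeds {R Q : List ℕ} {k : ℕ} {l : List ℕ} (h : embeds R Q k l = true) :
    ∃ l' : List ℕ, l'.length = l.length + k ∧ (∀ j < l.length, row l' j = row l j) ∧
      ∀ i, l.length ≤ i → i < l'.length → row l' i < R.length ∧
        ∀ j < i, bit (row R (row l' i)) (row l' j) = bit (row Q i) j := by
  induction k generalizing l with
  | zero => exact ⟨l, rfl, fun _ _ => rfl, fun i h₁ h₂ => absurd h₂ (not_lt.2 h₁)⟩
  | succ k ih =>
    obtain ⟨y, hy, h⟩ := List.any_eq_true.1 h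
    rw [force_eq, Bool.and_eq_true, List.all_eq_true] at h
    obtain ⟨l', hlen, hl', H⟩ := ih h.2
    have hlt : ∀ j < l.length, row l' j = row l j := fun j hj => by
      rw [hl' j (by simp; omega), row_eq, row_eq, List.getD_append _ _ _ _ hj]
    have heq : row l' l.length = y := by
      rw [hl' _ (by simp), row_eq]
      simp
    refine ⟨l', by simp at hlen; omega, hlt, fun i h₁ h₂ => ?_⟩
    rcases h₁.eq_or_lt with rfl | h₁
    · rw [heq]
      refine ⟨List.mem_range.1 hy, fun j hj => ?_⟩
      rw [hlt j hj]
      exact eq_of_beq (h.1 j (List.mem_range.2 hj))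
    · exact H i (by simp; omega) h₂

end InducedSearch

/-! ### Consequences of the forbidden subgraphs and of large degrees -/

namespace SimpleGraph

variable {V W : Type*}

/-- Since no two vertices of `H` have the same neighbours, preserving adjacency both ways forces
injectivity. -/
theorem isIndContained_of_adj_iff {H : SimpleGraph W} {G : SimpleGraph V} (f : W → V)
    (hH : ∀ i j, (∀ k, H.Adj i k ↔ H.Adj j k) → i = j)
    (hf : ∀ i j, G.Adj (f i) (f j) ↔ H.Adj i j) : H.IsIndContained G :=
  ⟨⟨f, fun i j h => hH i j fun k => by rw [← hf, ← hf, h]⟩, hf _ _⟩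

/-- Distinct nonadjacent vertices have at most one common neighbour. -/
theorem eq_of_common_neighbors {G : SimpleGraph V} (hC4 : (cycleGraph 4).IndFree G)
    (hdiamond : diamondGraph.IndFree G) {a b c d : V} (hab : a ≠ b) (hn : ¬G.Adj a b)
    (hac : G.Adj a c) (had : G.Adj a d) (hbc : G.Adj b c) (hbd : G.Adj b d) : c = d := by
  by_contra hcd
  have inj {x y z t : V} (h : [x, y, z, t].Nodup) : Function.Injective ![x, y, z, t] := by
    intro i j hij
    fin_cases i <;> fin_cases j <;> simp_all
  by_cases h : G.Adj c d
  · refine hdiamond ⟨⟨⟨![a, b, c, d], inj ?_⟩, fun {i j} => ?_⟩⟩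
    · simp [hab, hac.ne, had.ne, hbc.ne, hbd.ne, hcd]
    · fin_cases i <;> fin_cases j <;> simp [diamondGraph, *, G.adj_comm]
  · refine hC4 ⟨⟨⟨![a, c, b, d], inj ?_⟩, fun {i j} => ?_⟩⟩
    · simp [hab, hac.ne, had.ne, hbc.ne', hbd.ne, hcd]
    · fin_cases i <;> fin_cases j <;> simp [cycleGraph_adj, *] <;> grind [adj_comm]

/-- In a `P₇`-free and `C₇`-free graph, there is no path `a, …, g` all of whose chords join
its ends. -/
theorem not_inducedPath_of_indFree {G : SimpleGraph V} (hP7 : (pathGraph 7).IndFree G)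
    (hC7 : (cycleGraph 7).IndFree G) (p : Fin 7 → V)
    (hp : ∀ i j : Fin 7, i < j → (i, j) ≠ (0, 6) → (G.Adj (p i) (p j) ↔ i.val + 1 = j.val)) :
    False := by
  have key (H : SimpleGraph (Fin 7)) [DecidableRel H.Adj]
      (hH : ∀ i j, (∀ k, H.Adj i k ↔ H.Adj j k) → i = j)
      (h : ∀ i j : Fin 7, i < j → (i, j) ≠ (0, 6) → (H.Adj i j ↔ i.val + 1 = j.val))
      (h' : G.Adj (p 0) (p 6) ↔ H.Adj 0 6) : H.IsIndContained G := by
    refine isIndContained_of_adj_iff p hH fun i j => ?_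
    have key' (i j : Fin 7) (hij : i < j) : G.Adj (p i) (p j) ↔ H.Adj i j := by
      by_cases e : (i, j) = (0, 6)
      · obtain ⟨rfl, rfl⟩ := Prod.mk.inj e
        exact h'
      · rw [hp i j hij e, h i j hij e]
    rcases lt_trichotomy i j with hij | rfl | hij
    · exact key' i j hij
    · simp
    · rw [G.adj_comm, H.adj_comm, key' j i hij]
  -- The only undetermined pair decides between `C₇` and `P₇`.
  by_cases h : G.Adj (p 0) (p 6)
  · exact hC7 (key _ (by decide) (by decide) (by simpa [h] using by decide))
  · refine hP7 (@key _ (fun i j => decidable_of_iff _ pathGraph_adj.symm) ?_ ?_ ?_)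
    all_goals simp only [pathGraph_adj, h]
    all_goals decide

/-- If all degrees exceed the clique number, then each vertex has two neighbours that are not
adjacent to a given neighbour. -/
theorem exists_two_neighbors_not_adj [Fintype V] {G : SimpleGraph V} [DecidableRel G.Adj]
    (hG : ∀ a b c d, a ≠ b → ¬G.Adj a b → G.Adj a c → G.Adj a d → G.Adj b c → G.Adj b d → c = d)
    (hdeg : ∀ v, G.cliqueNum < G.degree v) {v u : V} (h : G.Adj v u) :
    ∃ x y, x ≠ y ∧ (G.Adj v x ∧ ¬G.Adj u x ∧ u ≠ x) ∧ (G.Adj v y ∧ ¬G.Adj u y ∧ u ≠ y) := by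
  classical
  let C := G.neighborFinset v ∩ G.neighborFinset u
  have hK : G.IsClique (insert v (insert u C) : Finset V) := by
    -- Two nonadjacent members of `C` would have both `v` and `u` as common neighbours.
    have hC : G.IsClique (C : Set V) := fun c hc d hd hcd => by
      simp only [C, Finset.coe_inter, Set.mem_inter_iff, Finset.mem_coe, mem_neighborFinset]
        at hc hd
      by_contra hn
      exact h.ne (hG c d v u hcd hn hc.1.symm hc.2.symm hd.1.symm hd.2.symm)
    simp only [Finset.coe_insert]
    refine (hC.insert fun c hc _ => ?_).insert fun c hc hvc => ?_
    · simp only [C, Finset.coe_inter, Set.mem_inter_iff, Finset.mem_coe, mem_neighborFinset] at hc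
      exact hc.2
    · rcases hc with rfl | hc
      · exact h
      · simp only [C, Finset.coe_inter, Set.mem_inter_iff, Finset.mem_coe, mem_neighborFinset]
          at hc
        exact hc.1
  have hcard := hK.card_le_cliqueNum
  rw [Finset.card_insert_of_notMem (by simp [C, h.ne]),
    Finset.card_insert_of_notMem (by simp [C])] at hcard
  let D := (G.neighborFinset v \ G.neighborFinset u).erase u
  have hD : (G.neighborFinset v \ G.neighborFinset u).card = D.card + 1 :=
    (Finset.card_erase_add_one (by simp [h])).symm
  have hsum := Finset.card_inter_add_card_sdiff (G.neighborFinset v) (G.neighborFinset u)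
  have hv := hdeg v
  rw [← G.card_neighborFinset_eq_degree] at hv
  -- `|C| + 2 ≤ ω < deg v` leaves at least three neighbours of `v` outside `C`, one of which is `u`.
  have : 1 < D.card := by
    change C.card + _ = _ at hsum
    omega
  obtain ⟨x, hx, y, hy, hxy⟩ := Finset.one_lt_card.1 this
  simp only [D, Finset.mem_erase, Finset.mem_sdiff, mem_neighborFinset] at hx hy
  exact ⟨x, y, hxy, ⟨hx.2.1, hx.2.2, hx.1.symm⟩, ⟨hy.2.1, hy.2.2, hy.1.symm⟩⟩

end SimpleGraph

/-! ### Running the search inside `G` -/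

namespace InducedSearch

open SimpleGraph

variable {V : Type*} {G : SimpleGraph V}

/-- `R` encodes the subgraph of `G` induced on the distinct vertices `f 0, …, f (n - 1)`. -/
structure Represents (G : SimpleGraph V) (R : List ℕ) (f : ℕ → V) : Prop where
  inj : ∀ i < R.length, ∀ j < R.length, f i = f j → i = j
  bit_iff : ∀ i < R.length, ∀ j, bit (row R i) j = true ↔ j < R.length ∧ G.Adj (f i) (f j)

theorem Represents.addVertex {R : List ℕ} {f : ℕ → V} (h : Represents G R f) {w : V} {S : ℕ}
    (hw : ∀ i < R.length, f i ≠ w)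
    (hS : ∀ j, bit S j = true ↔ j < R.length ∧ G.Adj w (f j)) :
    Represents G (addVertex R S) fun i => if i = R.length then w else f i where
  inj i hi j hj hij := by
    rw [addVertex_length] at hi hj
    have := h.inj i
    grind
  bit_iff i hi j := by
    rw [addVertex_length] at hi ⊢
    rcases (Nat.lt_succ_iff.1 hi).eq_or_lt with rfl | hi
    · rw [row_addVertex_length, hS]
      have := G.irrefl (v := w)
      grind
    · have hb := h.bit_iff i hi
      have hs := hS i
      have := G.adj_comm w (f i)
      rw [row_addVertex_of_lt hi]
      cases hSi : bit S i with
      | true =>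
        rw [cond_true, bit_lor, bit_pow, Bool.or_eq_true, hb, decide_eq_true_eq]
        grind
      | false =>
        rw [cond_false, hb]
        grind

theorem Represents.hasPath_eq_false
    (hP : ∀ p : Fin 7 → V, ¬∀ i j : Fin 7, i < j → (i, j) ≠ (0, 6) →
      (G.Adj (p i) (p j) ↔ i.val + 1 = j.val))
    {R : List ℕ} {f : ℕ → V} (h : Represents G R f) (w : ℕ) : hasPath R w = false := by
  by_contra hw
  rw [Bool.not_eq_false] at hw
  obtain ⟨a, b, c, d, e, g, hp, hwa, hN⟩ := exists_of_hasPath hw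
  have adj {x y : ℕ} (hxy : bit (row R x) y = true) : y < R.length ∧ G.Adj (f x) (f y) :=
    (h.bit_iff x (lt_length_of_bit hxy) y).1 hxy
  have not_adj {x y : ℕ} (hx : x < R.length) (hy : y < R.length)
      (hxy : bit (row R x) y = false) : ¬G.Adj (f x) (f y) := fun hc => by
    simp [(h.bit_iff x hx y).2 ⟨hy, hc⟩] at hxy
  simp only [IsInducedPath, List.forall_mem_cons] at hp hN
  obtain ⟨hab, ⟨hac, had, hae, hag, -⟩, hbc, ⟨hbd, hbe, hbg, -⟩, hcd, ⟨hce, hcg, -⟩, hde,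
    ⟨hdg, -⟩, heg, -, -⟩ := hp
  obtain ⟨hwb, hwc, hwd, hwe, -⟩ := hN
  have lw := lt_length_of_bit hwa
  have la := lt_length_of_bit hab
  have lb := lt_length_of_bit hbc
  have lc := lt_length_of_bit hcd
  have ld := lt_length_of_bit hde
  have le := lt_length_of_bit heg
  have lg := (adj heg).1
  refine hP ![f w, f a, f b, f c, f d, f e, f g] fun i j hij h06 => ?_
  fin_cases i <;> fin_cases j <;>
    first
    | exact absurd hij (by decide)
    | exact absurd rfl h06
    | exact iff_of_true (adj ‹_›).2 rfl
    | exact iff_of_false (not_adj ‹_› ‹_› ‹_›) (by decide)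

/-- A vertex outside of a represented subgraph leads to a branch of the search. -/
theorem Represents.exists_addVertex
    (hG : ∀ a b c d, a ≠ b → ¬G.Adj a b → G.Adj a c → G.Adj a d → G.Adj b c → G.Adj b d → c = d)
    {R : List ℕ} {f : ℕ → V} (h : Represents G R f) {w : V} (hw : ∀ i < R.length, f i ≠ w)
    {v u : ℕ} {p : ℕ → Bool} (hp : allMasks R v u p R.length 0 0 = true)
    (hv : ∀ i, bit v i = true → i < R.length ∧ G.Adj w (f i))
    (hu : ∀ i, bit u i = true → i < R.length → ¬G.Adj w (f i)) :
    ∃ S f', p S = true ∧ Represents G (InducedSearch.addVertex R S) f' ∧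
      ∀ j, bit S j = true ↔ j < R.length ∧ G.Adj w (f j) := by
  obtain ⟨S, hS⟩ := exists_mask (fun j => G.Adj w (f j)) R.length
  refine ⟨S, _, of_allMasks hp (fun i hi => ((hS i).1 hi).1) (fun i hi => (hS i).2 (hv i hi))
    (fun i hi => ?_) ?_ ?_, h.addVertex hw hS, hS⟩
  · rw [← Bool.not_eq_true, hS]
    exact fun hc => hu i hi hc.1 hc.2
  · intro i hi hiS b c hb hc hib hic
    rw [← Bool.not_eq_true, hS] at hiS
    rw [hS] at hb hc
    rw [h.bit_iff i hi] at hib hic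
    exact h.inj b hb.1 c hc.1 (hG (f i) w _ _ (hw i hi) (fun hc => hiS ⟨hi, hc.symm⟩)
      hib.2 hic.2 hb.2 hc.2)
  · intro i b hib hi hb c hic hbc
    rw [hS] at hi hb
    rw [h.bit_iff i hi.1] at hic ⊢
    rw [h.bit_iff b hb.1] at hbc
    rw [hS]
    -- Otherwise `f i` and `f b` have the common neighbours `f c` and `w`.
    have hadj : G.Adj (f i) (f b) := by
      by_contra hn
      exact hw c hic.1 (hG _ _ _ _ (fun e => hib (h.inj i hi.1 b hb.1 e)) hn hic.2 hi.2.symm hbc.2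
        hb.2.symm)
    refine ⟨⟨hb.1, hadj⟩, hic.1, ?_⟩
    -- Otherwise `w` and `f c` are nonadjacent with common neighbours `f i` and `f b`.
    by_contra hn
    exact hib (h.inj i hi.1 b hb.1
      (hG _ _ _ _ (hw c hic.1).symm hn hi.2 hb.2 hic.2.symm hbc.2.symm))

theorem exists_leaf_of_search
    (hG : ∀ a b c d, a ≠ b → ¬G.Adj a b → G.Adj a c → G.Adj a d → G.Adj b c → G.Adj b d → c = d)
    (hP : ∀ p : Fin 7 → V, ¬∀ i j : Fin 7, i < j → (i, j) ≠ (0, 6) →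
      (G.Adj (p i) (p j) ↔ i.val + 1 = j.val))
    (hD : ∀ v u, G.Adj v u →
      ∃ x y, x ≠ y ∧ (G.Adj v x ∧ ¬G.Adj u x ∧ u ≠ x) ∧ (G.Adj v y ∧ ¬G.Adj u y ∧ u ≠ y))
    {leaf : List ℕ → Bool} {k : ℕ} {R : List ℕ} {f : ℕ → V} (h : Represents G R f)
    (hs : search leaf k R = true) : ∃ R' f', Represents G R' f' ∧ leaf R' = true := by
  induction k generalizing R f with
  | zero => cases hs
  | succ k ih =>
    rw [search] at hs
    split at hs
    case h_2 => exact ⟨R, f, h, hs⟩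
    case h_1 v u hvu =>
      have hdef := List.find?_some hvu
      rw [deficient, Bool.and_eq_true, atMostOne_iff] at hdef
      obtain ⟨hvu, hone⟩ := hdef
      have hv := lt_length_of_bit hvu
      obtain ⟨hu, hadj⟩ := (h.bit_iff v hv u).1 hvu
      simp only [force_eq] at hs
      -- Deficiency leaves room for only one of the two neighbours given by `hD` among the
      -- represented vertices.
      obtain ⟨w, ⟨hvw, huw, -⟩, hw⟩ : ∃ w, (G.Adj (f v) w ∧ ¬G.Adj (f u) w ∧ f u ≠ w) ∧
          ∀ i < R.length, f i ≠ w := by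
        obtain ⟨x, y, hxy, hx, hy⟩ := hD _ _ hadj
        by_contra! hc
        obtain ⟨i, hi, rfl⟩ := hc x hx
        obtain ⟨j, hj, rfl⟩ := hc y hy
        have mem {i : ℕ} (hi : i < R.length)
            (hx : G.Adj (f v) (f i) ∧ ¬G.Adj (f u) (f i) ∧ f u ≠ f i) :
            bit (diff (row R v) (Nat.lor (row R u) (Nat.pow 2 u))) i = true := by
          rw [bit_diff, bit_lor, bit_pow, Bool.and_eq_true, Bool.not_eq_true', h.bit_iff v hv,
            Bool.or_eq_false_iff, decide_eq_false_iff_not, ← Bool.not_eq_true, h.bit_iff u hu]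
          exact ⟨⟨hi, hx.1⟩, fun hc => hx.2.1 hc.2, fun e => hx.2.2 (congrArg f e)⟩
        exact hxy (congrArg f (hone i j (mem hi hx) (mem hj hy)))
      obtain ⟨S, f', hp, hf', -⟩ := h.exists_addVertex hG hw hs
        (fun i hi => by
          rw [← Nat.pow_eq, bit_pow, decide_eq_true_eq] at hi
          exact hi ▸ ⟨hv, hvw.symm⟩)
        (fun i hi _ => by
          rw [← Nat.pow_eq, bit_pow, decide_eq_true_eq] at hi
          exact hi ▸ fun hc => huw hc.symm)
      rw [forceList_eq, hf'.hasPath_eq_false hP, Bool.false_or] at hp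
      exact ih hf' hp

theorem petersenGraph_adj_iff (i j : Fin 10) :
    petersenGraph.Adj i j ↔ bit (row petersenRows i) j = true := by
  simp only [petersenGraph, fromEdgeSet_adj, Set.mem_insert_iff, Set.mem_singleton_iff]
  revert i j
  decide +kernel

theorem bit_petersenRows_lt {i j : ℕ} (h : bit (row petersenRows i) j = true) : j < 10 := by
  by_contra hj
  have hrow : row petersenRows i < 2 ^ j := by
    refine lt_of_lt_of_le ?_ (Nat.pow_le_pow_right two_pos (not_lt.1 hj))
    by_cases hi : i < 10
    · interval_cases i <;> decide
    · rw [row_eq, List.getD_eq_default _ _ (not_lt.1 hi)]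
      decide
  rw [bit_eq, Nat.testBit_lt_two_pow hrow] at h
  cases h

theorem Represents.petersenGraph_isIndContained {R : List ℕ} {f : ℕ → V} (h : Represents G R f)
    (hR : embeds R petersenRows 10 [] = true) : petersenGraph.IsIndContained G := by
  obtain ⟨l, hl, -, H⟩ := exists_of_embeds hR
  simp only [List.length_nil, Nat.zero_add, Nat.zero_le, true_implies] at hl H
  rw [hl] at H
  refine isIndContained_of_adj_iff (fun i => f (row l i)) ?_ fun i j => ?_
  · simp only [petersenGraph_adj_iff]
    decide +kernel
  · have key (i j : Fin 10) (hij : j < i) :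
        G.Adj (f (row l i)) (f (row l j)) ↔ petersenGraph.Adj i j := by
      obtain ⟨hi, hij'⟩ := H i i.2
      rw [petersenGraph_adj_iff, ← hij' j hij, h.bit_iff _ hi]
      exact (and_iff_right (H j j.2).1).symm
    rcases lt_trichotomy i j with hij | rfl | hij
    · rw [G.adj_comm, petersenGraph.adj_comm, key j i hij]
    · simp
    · exact key i j hij

end InducedSearch

/-! ### The Petersen graph occurs and fills `G` -/

namespace SimpleGraph

open InducedSearch

variable {V : Type*} {G : SimpleGraph V}

theorem petersenGraph_isIndContained
    (hG : ∀ a b c d, a ≠ b → ¬G.Adj a b → G.Adj a c → G.Adj a d → G.Adj b c → G.Adj b d → c = d)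
    (hP : ∀ p : Fin 7 → V, ¬∀ i j : Fin 7, i < j → (i, j) ≠ (0, 6) →
      (G.Adj (p i) (p j) ↔ i.val + 1 = j.val))
    (hD : ∀ v u, G.Adj v u →
      ∃ x y, x ≠ y ∧ (G.Adj v x ∧ ¬G.Adj u x ∧ u ≠ x) ∧ (G.Adj v y ∧ ¬G.Adj u y ∧ u ≠ y))
    {a b : V} (hab : G.Adj a b) : petersenGraph.IsIndContained G := by
  have h : Represents G [2, 1] fun i => if i = 0 then a else b := by
    have hba := hab.symm
    have hne := hab.ne
    refine ⟨fun i hi j hj => ?_, fun i hi j => ?_⟩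
    · simp only [List.length_cons, List.length_nil] at hi hj
      grind
    · simp only [List.length_cons, List.length_nil] at hi ⊢
      interval_cases i
      · change bit (Nat.pow 2 1) j = true ↔ _
        rw [bit_pow, decide_eq_true_eq]
        grind [G.irrefl]
      · change bit (Nat.pow 2 0) j = true ↔ _
        rw [bit_pow, decide_eq_true_eq]
        grind [G.irrefl]
  obtain ⟨R, f, hR, hleaf⟩ := exists_leaf_of_search hG hP hD h search_edge
  exact hR.petersenGraph_isIndContained hleaf

theorem surjective_of_petersenGraph_embedding
    (hG : ∀ a b c d, a ≠ b → ¬G.Adj a b → G.Adj a c → G.Adj a d → G.Adj b c → G.Adj b d → c = d)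
    (hP : ∀ p : Fin 7 → V, ¬∀ i j : Fin 7, i < j → (i, j) ≠ (0, 6) →
      (G.Adj (p i) (p j) ↔ i.val + 1 = j.val))
    (hD : ∀ v u, G.Adj v u →
      ∃ x y, x ≠ y ∧ (G.Adj v x ∧ ¬G.Adj u x ∧ u ≠ x) ∧ (G.Adj v y ∧ ¬G.Adj u y ∧ u ≠ y))
    (hconn : G.Connected) (φ : petersenGraph ↪g G) : Function.Surjective φ := by
  intro z
  by_contra hz
  obtain ⟨W⟩ := hconn.preconnected (φ 0) z
  -- A walk leaving the image gives an outside vertex attached to it, so its mask `S` is nonzero.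
  obtain ⟨d, -, ⟨i, hi⟩, hd⟩ := W.exists_boundary_dart (Set.range φ) ⟨0, rfl⟩ hz
  have h : Represents G petersenRows fun i => φ (Fin.ofNat 10 i) := by
    have val {i : ℕ} (hi : i < 10) : (Fin.ofNat 10 i).val = i := Nat.mod_eq_of_lt hi
    refine ⟨fun i hi j hj hij => ?_, fun i hi j => ?_⟩
    · rw [← val hi, ← val hj, φ.injective hij]
    · rw [φ.map_adj_iff, petersenGraph_adj_iff, val hi]
      refine ⟨fun hb => ?_, fun hb => ?_⟩
      · have hj := bit_petersenRows_lt hb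
        exact ⟨hj, by rwa [val hj]⟩
      · rw [val hb.1] at hb
        exact hb.2
  obtain ⟨S, f, hp, hf, hS⟩ := h.exists_addVertex hG (w := d.snd) (fun i _ e => hd ⟨_, e⟩)
    search_petersen_extension (by simp [bit_zero]) (by simp [bit_zero])
  have hSi : bit S i = true := (hS i).2 ⟨i.2, by simpa [hi] using d.adj.symm⟩
  have hS0 : Nat.beq S 0 = false :=
    Bool.eq_false_iff.2 fun e => by simp [Nat.eq_of_beq_eq_true e, bit_zero] at hSi
  rw [hS0, Bool.false_or, forceList_eq, hf.hasPath_eq_false hP, Bool.false_or] at hp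
  -- A successful search yields a leaf, but here no graph is accepted as one.
  obtain ⟨_, _, -, hfalse⟩ := exists_leaf_of_search hG hP hD hf hp
  cases hfalse

end SimpleGraph

theorem mainTheorem6 {V : Type*} [Fintype V] (G : SimpleGraph V) [DecidableRel G.Adj]
    (hconn : G.Connected)
    (hP7 : (SimpleGraph.pathGraph 7).IndFree G)
    (hC7 : (SimpleGraph.cycleGraph 7).IndFree G)
    (hC4 : (SimpleGraph.cycleGraph 4).IndFree G)
    (hdiamond : SimpleGraph.diamondGraph.IndFree G) :
    Nonempty (G ≃g SimpleGraph.petersenGraph) ∨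
      (∃ K : Set V, G.IsCliqueCutset K) ∨
      (∃ v : V, G.degree v ≤ G.cliqueNum) := by
  by_contra! hc
  obtain ⟨hpet, -, hdeg⟩ := hc
  have hG (a b c d : V) := SimpleGraph.eq_of_common_neighbors hC4 hdiamond (a := a) (b := b)
    (c := c) (d := d)
  have hP := fun p => SimpleGraph.not_inducedPath_of_indFree hP7 hC7 p
  have hD := fun v u => SimpleGraph.exists_two_neighbors_not_adj hG hdeg (v := v) (u := u)
  obtain ⟨v⟩ := hconn.nonempty
  obtain ⟨u, hvu⟩ := (G.degree_pos_iff_exists_adj v).1 (Nat.zero_lt_of_lt (hdeg v))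
  obtain ⟨φ⟩ := SimpleGraph.petersenGraph_isIndContained hG hP hD hvu
  have hφ := SimpleGraph.surjective_of_petersenGraph_embedding hG hP hD hconn φ
  exact hpet.elim (RelIso.ofSurjective φ hφ).symm
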